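/- Let $\mathbb K$ be a field, $S=\mathbb K[x_1,\dots,x_n]$, and let $\Delta$ be a nonempty simplicial complex on $[n]=\{1,\dots,n\}$, i.e. a nonempty family of subsets of $[n]$, called faces, that is closed under taking subsets (elements of $[n]$ that lie in no face are allowed). $\Delta$ is a matroid if for all $I,J\in\Delta$ with $\#J<\#I$ there is $v\in I\setminus J$ with $J\cup\{v\}\in\Delta$. Let $I_\Delta=\langle \prod_{i\in F}x_i : F\subseteq[n],\ F\notin\Delta\rangle\subseteq S$ be the Stanley–Reisner ideal, let $T^1(\Delta)$ be the cokernel of the natural map $\operatorname{Der}_{\mathbb K}(S,S)\to\operatorname{Hom}_S(I_\Delta,S/I_\Delta)$, and for $\mathbf c\in\mathbb Z^n$ let $T^1_{\mathbf c}(\Delta)$ be its component of degree $\mathbf c$ in the natural $\mathbb Z^n$-grading. For $A\subseteq[n]$ put $\operatorname{link}_\Delta A=\{F\in\Delta : F\cap A=\emptyset,\ F\cup A\in\Delta\}$. The circuits of a complex are its minimal nonfaces, and $\mathcal C_{\Gamma}(\mathbf b)$ denotes the set of circuits $C$ of $\Gamma$ with $\mathbf b\subseteq C$. For $\mathbf b\subseteq[n]$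 let $$N_{\mathbf b}(\Delta)=\{F\in\Delta : F\cap\mathbf b=\emptyset,\ F\cup\mathbf b\notin\Delta\},\qquad \widetilde N_{\mathbf b}(\Delta)=\{F\in N_{\mathbf b}(\Delta) : \exists\,\mathbf b'\subsetneq\mathbf b,\ F\cup\mathbf b'\notin\Delta\}.$$ Theorem. $\Delta$ is a matroid if and only if for all $\mathbf a\in\mathbb Z_{\ge 0}^n$ and $\mathbf b\in\{0,1\}^n$ with disjoint supports, writing $A=\operatorname{supp}\mathbf a$ and identifying $\mathbf b$ with its support, $$\dim_{\mathbb K} T^1_{\mathbf a-\mathbf b}(\Delta)=\begin{cases}0 & \text{if } A\notin\Delta \text{ or } \mathbf b=\emptyset \text{ or } \widetilde N_{\mathbf b}(\Delta)\neq\emptyset,\\ \max\{\#\mathcal C_{\operatorname{link}_\Delta A}(\mathbf b)-1,\,0\} & \text{otherwise, if } \#\mathbf b=1,\\ \#\mathcal C_{\operatorname{link}_\Delta A}(\mathbf b) & \text{otherwise.}\end{cases}$$ -/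

import Mathlib

namespace MatroidT1

/-- An abstract simplicial complex on the ground set `Fin n`: a family of subsets closed under
passing to subsets. The void family, and elements of the ground set that lie in no face, are
allowed. -/
@[ext]
structure SimplicialCpx (n : ℕ) where
  faces : Set (Finset (Fin n))
  down_closed : ∀ {F G : Finset (Fin n)}, F ∈ faces → G ⊆ F → G ∈ faces

namespace SimplicialCpx

variable {n : ℕ}

/-- A nonempty simplicial complex whose faces satisfy the exchange axiom for independent sets. -/
def IsMatroid (Δ : SimplicialCpx n) : Prop :=
  Δ.faces.Nonempty ∧
    ∀ I J : Finset (Fin n), I ∈ Δ.faces → J ∈ Δ.faces → J.card < I.card →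
      ∃ v ∈ I \ J, insert v J ∈ Δ.faces

/-- `IsMatroid` says that the faces are the independent sets of a matroid with ground set
`Fin n` in Mathlib's sense. -/
theorem isMatroid_iff_exists_matroid (Δ : SimplicialCpx n) :
    Δ.IsMatroid ↔ ∃ M : Matroid (Fin n), M.E = Set.univ ∧
      ∀ F : Finset (Fin n), M.Indep (F : Set (Fin n)) ↔ F ∈ Δ.faces := by
  constructor
  · rintro ⟨⟨F, hF⟩, hex⟩
    refine ⟨(IndepMatroid.ofFinset Set.univ (fun I => I ∈ Δ.faces)
      (Δ.down_closed hF (Finset.empty_subset _)) (fun _ _ hJ hIJ => Δ.down_closed hJ hIJ)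
      (fun I J hI hJ h => ?_) (fun _ _ => Set.subset_univ _)).matroid, rfl, fun G => ?_⟩
    · obtain ⟨v, hv, hvI⟩ := hex J I hJ hI h
      rw [Finset.mem_sdiff] at hv
      exact ⟨v, hv.1, hv.2, hvI⟩
    · simp
  · rintro ⟨M, -, hM⟩
    refine ⟨⟨∅, (hM ∅).1 (by simp)⟩, fun I J hI hJ h => ?_⟩
    obtain ⟨v, hv, hvJ⟩ := ((hM J).2 hJ).augment ((hM I).2 hI)
      (by simpa [Set.encard_coe_eq_coe_finsetCard] using h)
    refine ⟨v, by simpa using hv, (hM _).1 (by simpa using hvJ)⟩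

/-- The link of `A`: all faces disjoint from `A` whose union with `A` is a face. It is regarded
as a complex on the same ground set. -/
def link (Δ : SimplicialCpx n) (A : Finset (Fin n)) : SimplicialCpx n where
  faces := {F | F ∈ Δ.faces ∧ Disjoint F A ∧ F ∪ A ∈ Δ.faces}
  down_closed := fun hF hG =>
    ⟨Δ.down_closed hF.1 hG, hF.2.1.mono_left hG,
      Δ.down_closed hF.2.2 (Finset.union_subset_union_left hG)⟩

/-- The minimal nonfaces (circuits) of `Δ`. -/
def circuits (Δ : SimplicialCpx n) : Set (Finset (Fin n)) :=
  {C | C ∉ Δ.faces ∧ ∀ D, D ⊂ C → D ∈ Δ.faces}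

/-- The minimal nonfaces (circuits) of `Δ` that contain `b`. -/
def circuitsContaining (Δ : SimplicialCpx n) (b : Finset (Fin n)) : Set (Finset (Fin n)) :=
  {C | C ∈ Δ.circuits ∧ b ⊆ C}

/-- `N_b(Δ)`: the faces `F` disjoint from `b` such that `F ∪ b` is not a face. -/
def nSet (Δ : SimplicialCpx n) (b : Finset (Fin n)) : Set (Finset (Fin n)) :=
  {F | F ∈ Δ.faces ∧ Disjoint F b ∧ F ∪ b ∉ Δ.faces}

/-- `Ñ_b(Δ)`: the `F ∈ N_b(Δ)` such that `F ∪ b'` is a nonface for some proper subset `b'` of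
`b`. -/
def nTildeSet (Δ : SimplicialCpx n) (b : Finset (Fin n)) : Set (Finset (Fin n)) :=
  {F | F ∈ Δ.nSet b ∧ ∃ b', b' ⊂ b ∧ F ∪ b' ∉ Δ.faces}

open Classical in
/-- The circuit count predicted for the dimension of `T¹` in degree `a - b`, where `A` is the
support of `a`. The subtraction is that of `ℕ`, so the second case is
`max (#circuits - 1) 0`. -/
noncomputable def circuitFormula (Δ : SimplicialCpx n) (A b : Finset (Fin n)) : ℕ :=
  if A ∉ Δ.faces ∨ b = ∅ ∨ (Δ.nTildeSet b).Nonempty then 0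
  else if b.card = 1 then ((Δ.link A).circuitsContaining b).ncard - 1
  else ((Δ.link A).circuitsContaining b).ncard

/-- The Stanley-Reisner ideal over `K`, generated by the monomials of all nonfaces. -/
noncomputable def stanleyReisnerIdeal (K : Type*) [Field K] (Δ : SimplicialCpx n) :
    Ideal (MvPolynomial (Fin n) K) :=
  Ideal.span {p | ∃ F : Finset (Fin n), F ∉ Δ.faces ∧ p = ∏ i ∈ F, MvPolynomial.X i}

end SimplicialCpx

section Cotangent

variable {K : Type*} [Field K] {n : ℕ}

/-- The natural map `Der_K(S,S) → Hom_S(I, S/I)`, `∂ ↦ (f ↦ ∂ f mod I)`. -/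
noncomputable def derToHom (I : Ideal (MvPolynomial (Fin n) K)) :
    Derivation K (MvPolynomial (Fin n) K) (MvPolynomial (Fin n) K) →ₗ[MvPolynomial (Fin n) K]
      (I →ₗ[MvPolynomial (Fin n) K] MvPolynomial (Fin n) K ⧸ I) where
  toFun D :=
    { toFun := fun f => Ideal.Quotient.mk I (D f)
      map_add' := fun f g => by simp
      map_smul' := fun r f => by
        have h : Ideal.Quotient.mk I (f : MvPolynomial (Fin n) K) = 0 :=
          Ideal.Quotient.eq_zero_iff_mem.2 f.2
        have h' : r • Ideal.Quotient.mk I (D f) = Ideal.Quotient.mk I (r * D f) := rfl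
        simp [h, h'] }
  map_add' D E := by ext f; simp
  map_smul' r D := rfl

/-- The first cotangent cohomology module `T¹(S/I)`: the cokernel of
`Der_K(S,S) → Hom_S(I, S/I)`. -/
abbrev T1 (I : Ideal (MvPolynomial (Fin n) K)) : Type _ :=
  (I →ₗ[MvPolynomial (Fin n) K] MvPolynomial (Fin n) K ⧸ I) ⧸ LinearMap.range (derToHom I)

/-- The component `S_d` of `S = K[x_1,…,x_n]` in degree `d ∈ ℤⁿ`: all polynomials whose only
monomial has exponent `d`. It is zero if `d` has a negative entry. -/
noncomputable def polyComponent (K : Type*) [Field K] {n : ℕ} (d : Fin n → ℤ) :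
    Submodule K (MvPolynomial (Fin n) K) where
  carrier := {f | ∀ m : Fin n →₀ ℕ, f.coeff m ≠ 0 → ∀ i, (m i : ℤ) = d i}
  zero_mem' := by intro m hm; simp at hm
  add_mem' := by
    intro f g hf hg m hm
    by_cases h : f.coeff m = 0
    · exact hg m (fun h' => hm (by simp [h, h']))
    · exact hf m h
  smul_mem' := by
    intro r f hf m hm
    exact hf m (fun h => hm (by simp [h]))

/-- The component `Hom_S(I, S/I)_c`: the homomorphisms that send each `I ∩ S_d` into the image
of `S_{d + c}` in `S/I`. -/
noncomputable def homComponent (I : Ideal (MvPolynomial (Fin n) K)) (c : Fin n → ℤ) :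
    Submodule K (I →ₗ[MvPolynomial (Fin n) K] MvPolynomial (Fin n) K ⧸ I) where
  carrier := {φ | ∀ (d : Fin n → ℤ) (f : I), (f : MvPolynomial (Fin n) K) ∈ polyComponent K d →
    φ f ∈ (polyComponent K (d + c)).map (Ideal.Quotient.mkₐ K I).toLinearMap}
  zero_mem' := by intro d f _; exact Submodule.zero_mem _
  add_mem' := by intro φ ψ hφ hψ d f hf; exact Submodule.add_mem _ (hφ d f hf) (hψ d f hf)
  smul_mem' := by intro r φ hφ d f hf; exact Submodule.smul_mem _ r (hφ d f hf)

/-- The component `T¹_c(S/I)`: the image in `T¹(S/I)` of the homomorphisms of degree `c`. -/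
noncomputable def T1Component (I : Ideal (MvPolynomial (Fin n) K)) (c : Fin n → ℤ) : Submodule K (T1 I) :=
  (homComponent I c).map ((LinearMap.range (derToHom I)).mkQ.restrictScalars K)

end Cotangent

/-- The degree `a - b ∈ ℤⁿ`, where `b` is identified with its 0/1 indicator vector. -/
def degreeSub {n : ℕ} (a : Fin n → ℕ) (b : Finset (Fin n)) : Fin n → ℤ :=
  fun i => (a i : ℤ) - if i ∈ b then 1 else 0

/-- The support of `a ∈ ℕⁿ`. -/
def supp {n : ℕ} (a : Fin n → ℕ) : Finset (Fin n) := Finset.univ.filter fun i => a i ≠ 0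

end MatroidT1

namespace MatroidT1

/-! ### Matroid combinatorics: augmentation, circuit elimination, exchange, circuits of links. -/

namespace SimplicialCpx

variable {n : ℕ}

/-! Write A for the support of a. A homomorphism of degree a - b sends each monomial of the ideal to
a scalar times one monomial, and these scalars agree along divisibility as long as the target stays
on a face. For nonempty b, every nonzero scalar can be traced to a monomial x^A x^C with C a circuit
of link A containing b. Hence evaluation at these monomials embeds Hom in degree a - b into the
functions on the circuits, for every complex (`eq_zero_of_evalCircuits_eq_zero`).

For a matroid the image is all or nothing. If Ñ_b is nonempty, each circuit monomial has a multiple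
that must map to zero although its target is a face monomial (`evalCircuits_eq_zero`). If Ñ_b is
empty, "multiply the multiples of x^C by x^(a-b), kill all other monomials" is well defined, by
basis exchange (`support_shift_notMem`), and gives the indicator function of C. Derivations
contribute nothing to the evaluations when b has at least two elements, and exactly the constant
functions when b is a singleton; this is the -1 in the formula.

Conversely, only the degrees -e_v are needed. There the formula forces evaluation to be onto,
whereas two circuits violating elimination at v always receive the same value
(`evalCircuits_eq_of_union_mem`). So circuits satisfy elimination, which characterizes matroids
(`isMatroid_of_elimination`). -/

theorem IsMatroid.augment {Δ : SimplicialCpx n} (h : Δ.IsMatroid) {I J : Finset (Fin n)}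
    (hI : I ∈ Δ.faces) (hJ : J ∈ Δ.faces) (hc : J.card ≤ I.card) :
    ∃ Y ∈ Δ.faces, J ⊆ Y ∧ Y ⊆ I ∪ J ∧ Y.card = I.card := by
  induction hk : I.card - J.card generalizing J with
  | zero => exact ⟨J, hJ, subset_rfl, Finset.subset_union_right, by omega⟩
  | succ k ih =>
    obtain ⟨v, hv, hvJ⟩ := h.2 I J hI hJ (by omega)
    rw [Finset.mem_sdiff] at hv
    have hcard := Finset.card_insert_of_notMem hv.2
    obtain ⟨Y, hY, h1, h2, h3⟩ := ih hvJ (by omega) (by omega)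
    refine ⟨Y, hY, (Finset.subset_insert _ _).trans h1, h2.trans ?_, h3⟩
    intro x
    simp only [Finset.mem_union, Finset.mem_insert]
    rintro (hx | rfl | hx)
    · exact Or.inl hx
    · exact Or.inl hv.1
    · exact Or.inr hx

theorem exists_circuit_subset {Δ : SimplicialCpx n} {X : Finset (Fin n)} (hX : X ∉ Δ.faces) :
    ∃ C ∈ Δ.circuits, C ⊆ X := by
  induction X using Finset.strongInduction with
  | H X ih =>
    by_cases h : ∀ D, D ⊂ X → D ∈ Δ.faces
    · exact ⟨X, ⟨hX, h⟩, subset_rfl⟩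
    · push Not at h
      obtain ⟨D, hD, hD'⟩ := h
      obtain ⟨C, hC, hCD⟩ := ih D hD hD'
      exact ⟨C, hC, hCD.trans hD.1⟩

theorem eq_of_circuit_subset {Δ : SimplicialCpx n} {C D : Finset (Fin n)} (hC : C ∈ Δ.circuits)
    (hD : D ∈ Δ.circuits) (h : C ⊆ D) : C = D := by
  by_contra hne
  exact hC.1 (hD.2 C (h.ssubset_of_ne hne))

theorem union_mem_of_mem_link {Δ : SimplicialCpx n} {A F : Finset (Fin n)}
    (h : F ∈ (Δ.link A).faces) : F ∪ A ∈ Δ.faces := h.2.2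

theorem mem_link_of_disjoint {Δ : SimplicialCpx n} {A F : Finset (Fin n)} (hd : Disjoint F A)
    (h : F ∪ A ∈ Δ.faces) : F ∈ (Δ.link A).faces :=
  ⟨Δ.down_closed h Finset.subset_union_left, hd, h⟩

/-- A complex whose circuits satisfy the elimination axiom is a matroid. -/
theorem isMatroid_of_elimination {Δ : SimplicialCpx n} (hne : Δ.faces.Nonempty)
    (h : ∀ C ∈ Δ.circuits, ∀ D ∈ Δ.circuits, C ≠ D → ∀ v ∈ C, v ∈ D →
      (C ∪ D).erase v ∉ Δ.faces) : Δ.IsMatroid := by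
  classical
  refine ⟨hne, fun I J hI hJ hlt => ?_⟩
  by_contra hno
  push Not at hno
  let P : Finset (Finset (Fin n)) :=
    Finset.univ.filter fun X => X ∈ Δ.faces ∧ X ⊆ J ∪ I ∧ J.card < X.card
  have hIP : I ∈ P := by simp [P, hI, hlt, Finset.subset_union_right]
  -- Among the faces in J ∪ I larger than J, take X as close to containing J as possible. It cannot
  -- contain J, since an element of X \ J would then augment J.
  obtain ⟨X, hXP, hmin⟩ := Finset.exists_min_image P (fun X => (J \ X).card) ⟨I, hIP⟩
  simp only [P, Finset.mem_filter, Finset.mem_univ, true_and] at hXP hmin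
  obtain ⟨hX, hXs, hXc⟩ := hXP
  have hJX : ¬ J ⊆ X := by
    intro hs
    obtain ⟨f, hf⟩ : (X \ J).Nonempty := by
      rw [Finset.sdiff_nonempty]
      intro h'
      exact absurd (Finset.card_le_card h') (by omega)
    rw [Finset.mem_sdiff] at hf
    have hfI : f ∈ I := by
      have := hXs hf.1
      simpa [hf.2] using this
    exact hno f (by simp [hfI, hf.2]) (Δ.down_closed hX (Finset.insert_subset hf.1 hs))
  obtain ⟨e, heJ, heX⟩ := Finset.not_subset.1 hJX
  have key : ∀ f ∈ X \ J, ∃ C ∈ Δ.circuits, C ⊆ insert e X ∧ f ∉ C ∧ e ∈ C := by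
    intro f hf
    rw [Finset.mem_sdiff] at hf
    -- Swapping f for e keeps the cardinality and brings X closer to J, so minimality forbids a
    -- face.
    have hT : insert e (X.erase f) ∉ Δ.faces := by
      intro hT
      have h1 := hmin _ ⟨hT, ?_, ?_⟩
      · have : J \ insert e (X.erase f) ⊂ J \ X := by
          refine ⟨fun x hx => ?_, fun hs => ?_⟩
          · simp only [Finset.mem_sdiff, Finset.mem_insert, Finset.mem_erase, not_or, not_and] at hx ⊢
            refine ⟨hx.1, fun hxX => hx.2.2 ?_ hxX⟩
            rintro rfl
            exact hf.2 hx.1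
          · have := hs (Finset.mem_sdiff.2 ⟨heJ, heX⟩)
            simp at this
        exact absurd (Finset.card_lt_card this) (by omega)
      · intro x hx
        simp only [Finset.mem_insert, Finset.mem_erase] at hx
        rcases hx with rfl | hx
        · exact Finset.mem_union_left _ heJ
        · exact hXs hx.2
      · rw [Finset.card_insert_of_notMem (by simp [heX]), Finset.card_erase_of_mem hf.1]
        omega
    obtain ⟨C, hC, hCs⟩ := exists_circuit_subset hT
    refine ⟨C, hC, hCs.trans (Finset.insert_subset_insert _ (Finset.erase_subset _ _)), ?_, ?_⟩
    · intro hfC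
      have := hCs hfC
      simp only [Finset.mem_insert, Finset.mem_erase, ne_eq, not_true_eq_false, false_and,
        or_false] at this
      exact heX (this ▸ hf.1)
    · by_contra heC
      refine hC.1 (Δ.down_closed hX fun x hx => ?_)
      have := hCs hx
      simp only [Finset.mem_insert, Finset.mem_erase] at this
      rcases this with rfl | h'
      · exact absurd hx heC
      · exact h'.2
  obtain ⟨g, hg⟩ : (X \ J).Nonempty := by
    rw [Finset.sdiff_nonempty]
    intro h'
    exact absurd (Finset.card_le_card h') (by omega)
  obtain ⟨C, hC, hCs, -, heC⟩ := key g hg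
  -- A second circuit D through e is chosen to avoid this f, so D differs from C, while C ∪ D
  -- without e stays inside the face X.
  obtain ⟨f, hfC, hfJ⟩ : ∃ f ∈ C, f ∉ J := by
    rw [← Finset.not_subset]
    exact fun hs => hC.1 (Δ.down_closed hJ hs)
  have hfX : f ∈ X := by
    have := hCs hfC
    rw [Finset.mem_insert] at this
    rcases this with rfl | h'
    · exact absurd heJ hfJ
    · exact h'
  obtain ⟨D, hD, hDs, hfD, heD⟩ := key f (by simp [hfX, hfJ])
  refine h C hC D hD (fun hCD => hfD (hCD ▸ hfC)) e heC heD (Δ.down_closed hX fun x hx => ?_)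
  simp only [Finset.mem_erase, Finset.mem_union] at hx
  have : x ∈ insert e X := hx.2.elim (fun h' => hCs h') (fun h' => hDs h')
  simpa [hx.1] using this

/-- If some `F ∈ Ñ_b(Δ)` exists, every face avoiding `b` of a matroid extends to a member of
`Ñ_b(Δ)`. -/
theorem IsMatroid.exists_superset_of_nTildeSet {Δ : SimplicialCpx n} (h : Δ.IsMatroid)
    {b G : Finset (Fin n)} (hb : (Δ.nTildeSet b).Nonempty) (hG : G ∈ Δ.faces)
    (hGb : Disjoint G b) :
    ∃ G' ∈ Δ.faces, G ⊆ G' ∧ Disjoint G' b ∧ ∃ i ∈ b, G' ∪ b.erase i ∉ Δ.faces := by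
  classical
  obtain ⟨F, ⟨hF, hFb, -⟩, b', hb', hFb'⟩ := hb
  obtain ⟨i, hib, hib'⟩ := Finset.exists_of_ssubset hb'
  have hFi : F ∪ b.erase i ∉ Δ.faces := by
    refine fun h' => hFb' (Δ.down_closed h' (Finset.union_subset_union_right fun x hx => ?_))
    exact Finset.mem_erase.2 ⟨fun e => hib' (e ▸ hx), hb'.1 hx⟩
  -- M is a basis of the complement of b; G' will be a basis of that complement containing G.
  obtain ⟨M, hM, hmax⟩ := Finset.exists_max_image
    (Finset.univ.filter fun X => X ∈ Δ.faces ∧ Disjoint X b) Finset.card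
    ⟨F, by simp [hF, hFb]⟩
  simp only [Finset.mem_filter, Finset.mem_univ, true_and] at hM hmax
  obtain ⟨G', hG', hGG', hG's, hG'c⟩ := h.augment hM.1 hG (hmax G ⟨hG, hGb⟩)
  have hG'b : Disjoint G' b := (Finset.disjoint_union_left.2 ⟨hM.2, hGb⟩).mono_left hG's
  refine ⟨G', hG', hGG', hG'b, i, hib, fun hX => hFi ?_⟩
  have hdX : Disjoint G' (b.erase i) := hG'b.mono_right (Finset.erase_subset _ _)
  have hcX := Finset.card_union_of_disjoint hdX
  -- Extend F inside F ∪ G' ∪ (b - i) to the size of G' ∪ (b - i). At most #G' elements of Y lie off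
  -- b, so Y must contain all of b - i, making F ∪ (b - i) a face.
  obtain ⟨Y, hY, hFY, hYs, hYc⟩ := h.augment hX hF (by have := hmax F ⟨hF, hFb⟩; omega)
  have h1 := hmax (Y \ b) ⟨Δ.down_closed hY Finset.sdiff_subset, Finset.sdiff_disjoint⟩
  have h2 : Y ∩ b ⊆ b.erase i := by
    intro x hx
    rw [Finset.mem_inter] at hx
    have := hYs hx.1
    simp only [Finset.mem_union] at this
    rcases this with (h' | h') | h'
    · exact absurd hx.2 (Finset.disjoint_left.1 hG'b h')
    · exact h'
    · exact absurd hx.2 (Finset.disjoint_left.1 hFb h')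
  have h3 := Finset.card_sdiff_add_card_inter Y b
  have h4 : Y ∩ b = b.erase i := Finset.eq_of_subset_of_card_le h2 (by omega)
  exact Δ.down_closed hY (Finset.union_subset hFY (h4 ▸ Finset.inter_subset_left))

/-- In a matroid, let `I` be a face with `i ∈ I` and `j ∉ I`. If some face `P` contained in
`(I ∪ {j}) \ {i}` becomes a nonface on adding `i`, then `(I ∪ {j}) \ {i}` is a face. -/
theorem IsMatroid.exchange_mem {Δ : SimplicialCpx n} (h : Δ.IsMatroid) {I P : Finset (Fin n)}
    {i j : Fin n} (hI : I ∈ Δ.faces) (hi : i ∈ I) (hj : j ∉ I) (hP : P ∈ Δ.faces)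
    (hPI : P ⊆ insert j (I.erase i)) (hiP : insert i P ∉ Δ.faces) :
    insert j (I.erase i) ∈ Δ.faces := by
  classical
  have hc : (insert j (I.erase i)).card = I.card := by
    rw [Finset.card_insert_of_notMem (by simp [hj]), Finset.card_erase_of_mem hi]
    have := Finset.card_pos.2 ⟨i, hi⟩
    omega
  -- Extending P by elements of I can never use i, so the result fills up the exchanged set.
  obtain ⟨Y, hY, hPY, hYs, hYc⟩ := h.augment hI hP (hc ▸ Finset.card_le_card hPI)
  have hiY : i ∉ Y := fun h' => hiP (Δ.down_closed hY (Finset.insert_subset h' hPY))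
  have hYs' : Y ⊆ insert j (I.erase i) := by
    intro x hx
    have := hYs hx
    rw [Finset.mem_union] at this
    rcases this with h' | h'
    · exact Finset.mem_insert_of_mem (Finset.mem_erase.2 ⟨fun e => hiY (e ▸ hx), h'⟩)
    · exact hPI h'
  rwa [← Finset.eq_of_subset_of_card_le hYs' (by omega)]

/-- A circuit of `link A` that contains a nonempty set disjoint from `A` is disjoint from `A`. -/
theorem disjoint_of_circuit_link {Δ : SimplicialCpx n} {A b C : Finset (Fin n)}
    (hb : b.Nonempty) (hAb : Disjoint A b) (hC : C ∈ (Δ.link A).circuitsContaining b) :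
    Disjoint C A := by
  rw [Finset.disjoint_left]
  intro i hiC hiA
  obtain ⟨j, hj⟩ := hb
  have hs : ({i} : Finset (Fin n)) ⊂ C := by
    refine ⟨by simpa using hiC, fun hs => ?_⟩
    have := hs (hC.2 hj)
    rw [Finset.mem_singleton] at this
    exact Finset.disjoint_left.1 hAb hiA (this ▸ hj)
  have := (hC.1.2 _ hs).2.1
  simp [hiA] at this

theorem circuit_link_union_notMem {Δ : SimplicialCpx n} {A b C : Finset (Fin n)}
    (hb : b.Nonempty) (hAb : Disjoint A b) (hC : C ∈ (Δ.link A).circuitsContaining b) :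
    C ∪ A ∉ Δ.faces :=
  fun h => hC.1.1 (mem_link_of_disjoint (disjoint_of_circuit_link hb hAb hC) h)

theorem circuit_link_sdiff_mem {Δ : SimplicialCpx n} {A b C : Finset (Fin n)}
    (hb : b.Nonempty) (hC : C ∈ (Δ.link A).circuitsContaining b) :
    (C \ b) ∪ A ∈ Δ.faces :=
  union_mem_of_mem_link (hC.1.2 _ (Finset.sdiff_ssubset hC.2 hb))

theorem link_empty (Δ : SimplicialCpx n) : Δ.link ∅ = Δ := by
  ext F
  simp [link]

end SimplicialCpx

open MvPolynomial

/-! ### Monomials, coefficients and graded homomorphisms on the Stanley–Reisner ideal. -/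

section Monomials
variable {K : Type*} [Field K] {n : ℕ}

/-- The exponent vector with entries `f i`. -/
noncomputable def expo (f : Fin n → ℕ) : Fin n →₀ ℕ := Finsupp.equivFunOnFinite.symm f

@[simp] theorem expo_apply (f : Fin n → ℕ) (i : Fin n) : expo f i = f i := rfl

theorem monomial_mem_stanleyReisnerIdeal (Δ : SimplicialCpx n) {m : Fin n →₀ ℕ}
    (h : m.support ∉ Δ.faces) (r : K) : monomial m r ∈ Δ.stanleyReisnerIdeal K := by
  have h1 : (∏ i ∈ m.support, (X i : MvPolynomial (Fin n) K)) ∣ monomial m r := by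
    rw [monomial_eq, Finsupp.prod]
    refine Dvd.dvd.mul_left (Finset.prod_dvd_prod_of_dvd _ _ fun i hi => ?_) _
    exact dvd_pow_self _ (Finsupp.mem_support_iff.1 hi)
  exact Ideal.mem_of_dvd _ h1 (Ideal.subset_span ⟨_, h, rfl⟩)

theorem mem_stanleyReisnerIdeal_iff (Δ : SimplicialCpx n) {f : MvPolynomial (Fin n) K} :
    f ∈ Δ.stanleyReisnerIdeal K ↔ ∀ m ∈ f.support, m.support ∉ Δ.faces := by
  constructor
  · intro hf
    have hspan : Δ.stanleyReisnerIdeal K ≤ Ideal.span ((fun s => monomial s (1 : K)) ''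
        {m : Fin n →₀ ℕ | m.support ∉ Δ.faces}) := by
      refine Ideal.span_le.2 ?_
      rintro _ ⟨F, hF, rfl⟩
      refine Ideal.subset_span ⟨expo fun i => if i ∈ F then 1 else 0, ?_, ?_⟩
      · have : (expo fun i => if i ∈ F then 1 else 0).support = F := by
          ext i
          simp
        simpa [this] using hF
      · simp only [monomial_eq, map_one, one_mul]
        rw [Finsupp.prod_fintype _ _ (by simp)]
        simp [expo_apply, pow_ite, Finset.prod_ite_mem]
    intro m hm hface
    obtain ⟨s, hs, hsm⟩ := mem_ideal_span_monomial_image.1 (hspan hf) m hm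
    exact hs (Δ.down_closed hface (Finsupp.support_mono hsm))
  · intro h
    rw [f.as_sum]
    exact Ideal.sum_mem _ fun m hm => monomial_mem_stanleyReisnerIdeal Δ (h m hm) _

/-- The monomial `x^m`, as an element of the Stanley-Reisner ideal. -/
noncomputable def mon (K : Type*) [Field K] (Δ : SimplicialCpx n) (m : Fin n →₀ ℕ)
    (h : m.support ∉ Δ.faces) : Δ.stanleyReisnerIdeal K :=
  ⟨monomial m 1, monomial_mem_stanleyReisnerIdeal Δ h 1⟩

theorem hom_ext_mon {Δ : SimplicialCpx n}
    {φ : Δ.stanleyReisnerIdeal K →ₗ[MvPolynomial (Fin n) K]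
      MvPolynomial (Fin n) K ⧸ Δ.stanleyReisnerIdeal K}
    (h : ∀ m hm, φ (mon K Δ m hm) = 0) : φ = 0 := by
  ext f
  have hf := (mem_stanleyReisnerIdeal_iff Δ).1 f.2
  have : f = ∑ m ∈ (f : MvPolynomial (Fin n) K).support.attach,
      (C (coeff m.1 (f : MvPolynomial (Fin n) K)) : MvPolynomial (Fin n) K) •
        mon K Δ m.1 (hf m.1 m.2) := by
    apply Subtype.ext
    rw [AddSubmonoidClass.coe_finsetSum]
    conv_lhs => rw [(f : MvPolynomial (Fin n) K).as_sum, ← Finset.sum_attach]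
    refine Finset.sum_congr rfl fun m _ => ?_
    simp [mon, C_mul_monomial]
  rw [this, map_sum]
  simp [h]

/-- The coefficient of a face monomial `x^q`, as a functional on the Stanley-Reisner ring. It is
zero if `q` is not supported on a face. -/
noncomputable def coeffQ (K : Type*) [Field K] (Δ : SimplicialCpx n) (q : Fin n →₀ ℕ) :
    (MvPolynomial (Fin n) K ⧸ Δ.stanleyReisnerIdeal K) →ₗ[K] K := by
  classical
  -- Congruent polynomials differ only in nonface monomials, so the choice of representative made
  -- below does not affect face coefficients.
  have key : ∀ f g : MvPolynomial (Fin n) K, q.support ∈ Δ.faces →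
      Ideal.Quotient.mk (Δ.stanleyReisnerIdeal K) f = Ideal.Quotient.mk _ g →
      coeff q f = coeff q g := by
    intro f g hq h
    by_contra hne
    refine (mem_stanleyReisnerIdeal_iff Δ).1 (Ideal.Quotient.eq.1 h) q ?_ hq
    rw [mem_support_iff, coeff_sub]
    exact sub_ne_zero.2 hne
  exact
  { toFun := fun y => if q.support ∈ Δ.faces then coeff q (Quotient.out y) else 0
    map_add' := fun x y => by
      split_ifs with hq
      · rw [← coeff_add]
        refine key _ _ hq ?_
        rw [map_add]
        simp only [Ideal.Quotient.mk_out]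
      · simp
    map_smul' := fun r x => by
      split_ifs with hq
      · rw [RingHom.id_apply, ← coeff_smul]
        refine key _ _ hq ?_
        rw [← Ideal.Quotient.mkₐ_eq_mk K, map_smul, Ideal.Quotient.mkₐ_eq_mk]
        simp only [Ideal.Quotient.mk_out]
      · simp }

theorem coeffQ_mk {Δ : SimplicialCpx n} {q : Fin n →₀ ℕ} (hq : q.support ∈ Δ.faces)
    (f : MvPolynomial (Fin n) K) :
    coeffQ K Δ q (Ideal.Quotient.mk _ f) = coeff q f := by
  classical
  change (if q.support ∈ Δ.faces then coeff q (Quotient.out _) else 0) = _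
  rw [if_pos hq]
  by_contra hne
  refine (mem_stanleyReisnerIdeal_iff (K := K) Δ).1 (Ideal.Quotient.eq.1 (Ideal.Quotient.mk_out
    (Ideal.Quotient.mk (Δ.stanleyReisnerIdeal K) f))) q ?_ hq
  rw [mem_support_iff, coeff_sub]
  exact sub_ne_zero.2 hne

theorem coeffQ_monomial_smul {Δ : SimplicialCpx n} {q u : Fin n →₀ ℕ}
    (hq : (q + u).support ∈ Δ.faces)
    (y : MvPolynomial (Fin n) K ⧸ Δ.stanleyReisnerIdeal K) :
    coeffQ K Δ (q + u) ((monomial u (1 : K)) • y) = coeffQ K Δ q y := by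
  obtain ⟨f, rfl⟩ := Ideal.Quotient.mk_surjective y
  have hq' : q.support ∈ Δ.faces :=
    Δ.down_closed hq (Finsupp.support_mono (le_add_of_nonneg_right zero_le))
  have : (monomial u (1 : K)) • Ideal.Quotient.mk (Δ.stanleyReisnerIdeal K) f =
      Ideal.Quotient.mk _ (monomial u 1 * f) := rfl
  rw [this, coeffQ_mk hq, coeffQ_mk hq', add_comm q u, coeff_monomial_mul, one_mul]

theorem mem_polyComponent_iff {d : Fin n → ℤ} {q : Fin n →₀ ℕ} (hq : ∀ i, (q i : ℤ) = d i)
    {f : MvPolynomial (Fin n) K} : f ∈ polyComponent K d ↔ f = monomial q (coeff q f) := by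
  constructor
  · intro hf
    ext m
    rw [coeff_monomial]
    split_ifs with h
    · rw [h]
    · by_contra hne
      exact h (Finsupp.ext fun i => by have := hf m hne i; have := hq i; omega)
  · intro hf m hm i
    rw [hf, coeff_monomial] at hm
    split_ifs at hm with h
    · rw [← h]
      exact hq i
    · exact absurd rfl hm

theorem eq_zero_of_mem_polyComponent {d : Fin n → ℤ} {i : Fin n} (hi : d i < 0)
    {f : MvPolynomial (Fin n) K} (hf : f ∈ polyComponent K d) : f = 0 := by
  ext m
  by_contra hne
  have := hf m hne i
  omega

theorem mon_mem_polyComponent {Δ : SimplicialCpx n} {m : Fin n →₀ ℕ} (h : m.support ∉ Δ.faces) :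
    (mon K Δ m h : MvPolynomial (Fin n) K) ∈ polyComponent K (fun i => (m i : ℤ)) := by
  rw [mem_polyComponent_iff (q := m) fun _ => rfl]
  simp [mon]

variable {Δ : SimplicialCpx n} {c : Fin n → ℤ}
  {φ : Δ.stanleyReisnerIdeal K →ₗ[MvPolynomial (Fin n) K]
      MvPolynomial (Fin n) K ⧸ Δ.stanleyReisnerIdeal K}

theorem hom_apply_mon (hφ : φ ∈ homComponent (Δ.stanleyReisnerIdeal K) c) {m q : Fin n →₀ ℕ}
    (hm : m.support ∉ Δ.faces) (hq : ∀ i, (q i : ℤ) = m i + c i) :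
    ∃ r, φ (mon K Δ m hm) = Ideal.Quotient.mk _ (monomial q r) := by
  obtain ⟨g, hg, hgφ⟩ := hφ _ _ (mon_mem_polyComponent hm)
  have := (mem_polyComponent_iff (q := q) (fun i => by simpa using hq i)).1 hg
  exact ⟨coeff q g, by rw [← this]; exact hgφ.symm⟩

/-- The source of all vanishing: a degree with a negative entry contains no monomial. It is applied
to nonface monomials that lack a variable of b. -/
theorem hom_apply_mon_eq_zero_of_neg (hφ : φ ∈ homComponent (Δ.stanleyReisnerIdeal K) c)
    {m : Fin n →₀ ℕ} (hm : m.support ∉ Δ.faces) {i : Fin n} (hi : (m i : ℤ) + c i < 0) :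
    φ (mon K Δ m hm) = 0 := by
  obtain ⟨g, hg, hgφ⟩ := hφ _ _ (mon_mem_polyComponent hm)
  rw [← hgφ, eq_zero_of_mem_polyComponent (i := i) (by simpa using hi) hg, map_zero]

theorem mon_add {m u : Fin n →₀ ℕ} (hm : m.support ∉ Δ.faces)
    (hmu : (m + u).support ∉ Δ.faces) :
    mon K Δ (m + u) hmu = (monomial u (1 : K)) • mon K Δ m hm := by
  apply Subtype.ext
  simp [mon, monomial_mul, add_comm]

theorem coeffQ_hom_add {m u q : Fin n →₀ ℕ} (hm : m.support ∉ Δ.faces)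
    (hmu : (m + u).support ∉ Δ.faces) (hq : (q + u).support ∈ Δ.faces) :
    coeffQ K Δ (q + u) (φ (mon K Δ (m + u) hmu)) = coeffQ K Δ q (φ (mon K Δ m hm)) := by
  rw [mon_add hm hmu, map_smul, coeffQ_monomial_smul hq]

/-- In a fixed degree the image of a monomial has at most one possible monomial, and that monomial
is zero in the quotient unless supported on a face. -/
theorem hom_eq_zero_of_coeffQ (hφ : φ ∈ homComponent (Δ.stanleyReisnerIdeal K) c)
    (h : ∀ m hm q, (∀ i, (q i : ℤ) = m i + c i) → q.support ∈ Δ.faces →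
      coeffQ K Δ q (φ (mon K Δ m hm)) = 0) : φ = 0 := by
  refine hom_ext_mon fun m hm => ?_
  by_cases hneg : ∃ i, (m i : ℤ) + c i < 0
  · obtain ⟨i, hi⟩ := hneg
    exact hom_apply_mon_eq_zero_of_neg hφ hm hi
  · push Not at hneg
    have hq : ∀ i, ((expo fun i => ((m i : ℤ) + c i).toNat) i : ℤ) = m i + c i := fun i => by
      simpa using hneg i
    obtain ⟨r, hr⟩ := hom_apply_mon hφ hm hq
    by_cases hface : (expo fun i => ((m i : ℤ) + c i).toNat).support ∈ Δ.faces
    · have := h m hm _ hq hface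
      rw [hr, coeffQ_mk hface, coeff_monomial, if_pos rfl] at this
      rw [hr, this, map_zero, map_zero]
    · rw [hr]
      exact Ideal.Quotient.eq_zero_iff_mem.2 (monomial_mem_stanleyReisnerIdeal Δ hface r)

theorem mem_homComponent_of_mon
    (h : ∀ m hm, φ (mon K Δ m hm) ∈ (polyComponent K ((fun i => (m i : ℤ)) + c)).map
      (Ideal.Quotient.mkₐ K (Δ.stanleyReisnerIdeal K)).toLinearMap) :
    φ ∈ homComponent (Δ.stanleyReisnerIdeal K) c := by
  intro d f hf
  by_cases hf0 : (f : MvPolynomial (Fin n) K) = 0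
  · have : f = 0 := Subtype.ext hf0
    rw [this, map_zero]
    exact Submodule.zero_mem _
  · obtain ⟨m, hm⟩ := ne_zero_iff.1 hf0
    have hd : d = fun i => (m i : ℤ) := funext fun i => (hf m hm i).symm
    have hms := (mem_stanleyReisnerIdeal_iff Δ).1 f.2 m (mem_support_iff.2 hm)
    have hfm : f = coeff m (f : MvPolynomial (Fin n) K) • mon K Δ m hms := by
      apply Subtype.ext
      conv_lhs => rw [(mem_polyComponent_iff fun i => (hf m hm i)).1 hf]
      simp [mon, smul_monomial]
    rw [hfm, hd]
    have h2 := Submodule.smul_mem _ (coeff m (f : MvPolynomial (Fin n) K)) (h m hms)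
    have h3 : ∀ (r : K) (g : Δ.stanleyReisnerIdeal K), φ (r • g) = r • φ g := fun r g =>
      LinearMap.map_smul_of_tower φ r g
    rw [h3]
    exact h2

/-- A map on monomials that commutes with multiplication by variables modulo the
Stanley-Reisner ideal extends to a homomorphism. -/
theorem exists_hom_of_mon (t : (Fin n →₀ ℕ) → MvPolynomial (Fin n) K)
    (ht : ∀ m i, m.support ∉ Δ.faces →
      t (m + Finsupp.single i 1) - X i * t m ∈ Δ.stanleyReisnerIdeal K) :
    ∃ φ : Δ.stanleyReisnerIdeal K →ₗ[MvPolynomial (Fin n) K]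
      MvPolynomial (Fin n) K ⧸ Δ.stanleyReisnerIdeal K,
      ∀ m hm, φ (mon K Δ m hm) = Ideal.Quotient.mk _ (t m) := by
  -- Extend K-linearly to all of S. Compatibility with multiplication is available only on the
  -- ideal, which suffices because the ideal is stable in the induction on the multiplier.
  let T : MvPolynomial (Fin n) K →ₗ[K] MvPolynomial (Fin n) K :=
    (basisMonomials (Fin n) K).constr K t
  have hT : ∀ m, T (monomial m 1) = t m := fun m => by
    have := (basisMonomials (Fin n) K).constr_basis K t m
    rwa [coe_basisMonomials] at this
  have hTr : ∀ m r, T (monomial m r) = r • t m := fun m r => by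
    rw [← hT, ← map_smul, smul_monomial, smul_eq_mul, mul_one]
  have hX : ∀ i, ∀ f ∈ Δ.stanleyReisnerIdeal K,
      Ideal.Quotient.mk (Δ.stanleyReisnerIdeal K) (T (X i * f)) =
        Ideal.Quotient.mk _ (X i * T f) := by
    intro i f hf
    rw [Ideal.Quotient.eq]
    have hf' := (mem_stanleyReisnerIdeal_iff Δ).1 hf
    rw [f.as_sum, Finset.mul_sum, map_sum, map_sum, Finset.mul_sum, ← Finset.sum_sub_distrib]
    refine Ideal.sum_mem _ fun m hm => ?_
    rw [X, monomial_mul, one_mul, hTr, hTr, mul_smul_comm, ← smul_sub, add_comm]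
    exact Submodule.smul_of_tower_mem _ _ (ht m i (hf' m hm))
  have hmul : ∀ r : MvPolynomial (Fin n) K, ∀ f ∈ Δ.stanleyReisnerIdeal K,
      Ideal.Quotient.mk (Δ.stanleyReisnerIdeal K) (T (r * f)) = Ideal.Quotient.mk _ (r * T f) := by
    intro r
    induction r using MvPolynomial.induction_on with
    | C a =>
      intro f _
      rw [C_mul', map_smul, C_mul']
    | add p q hp hq =>
      intro f hf
      rw [add_mul, map_add, map_add, hp f hf, hq f hf, add_mul, map_add]
    | mul_X p i hp =>
      intro f hf
      rw [mul_assoc, hp _ (Ideal.mul_mem_left _ _ hf), map_mul, hX i f hf, ← map_mul, mul_assoc]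
  refine ⟨{ toFun := fun f => Ideal.Quotient.mk _ (T f)
            map_add' := fun f g => by simp
            map_smul' := fun r f => ?_ }, fun m hm => ?_⟩
  · exact hmul r f f.2
  · change Ideal.Quotient.mk _ (T (monomial m 1)) = _
    rw [hT]

end Monomials

/-! ### Evaluation at circuit monomials: injectivity and vanishing. -/

section Evaluation
variable {K : Type*} [Field K] {n : ℕ} {Δ : SimplicialCpx n}
  {φ : Δ.stanleyReisnerIdeal K →ₗ[MvPolynomial (Fin n) K]
      MvPolynomial (Fin n) K ⧸ Δ.stanleyReisnerIdeal K}

/-- Both monomials are compared through their quotient x^u: multiplication by x^u preserves a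
coefficient as long as the larger target is a face monomial. -/
theorem coeffQ_hom_of_le {m m' q q' : Fin n →₀ ℕ} (hm : m.support ∉ Δ.faces)
    (hm' : m'.support ∉ Δ.faces) (hle : ∀ i, m i ≤ m' i) (h : ∀ i, q' i + m i = q i + m' i)
    (hq' : q'.support ∈ Δ.faces) :
    coeffQ K Δ q' (φ (mon K Δ m' hm')) = coeffQ K Δ q (φ (mon K Δ m hm)) := by
  obtain ⟨u, rfl⟩ := exists_add_of_le (show m ≤ m' from hle)
  obtain rfl : q' = q + u := by
    ext i
    have := h i
    simp only [Finsupp.add_apply] at this ⊢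
    omega
  exact coeffQ_hom_add hm hm' hq'

theorem hom_mon_eq_zero_of_le {m m' : Fin n →₀ ℕ} (hm : m.support ∉ Δ.faces)
    (hm' : m'.support ∉ Δ.faces) (hle : ∀ i, m i ≤ m' i) (h : φ (mon K Δ m hm) = 0) :
    φ (mon K Δ m' hm') = 0 := by
  obtain ⟨u, rfl⟩ := exists_add_of_le (show m ≤ m' from hle)
  rw [mon_add hm hm', map_smul, h, smul_zero]

/-- The exponent of the squarefree monomials of `A` and `C`, multiplied. -/
noncomputable def circuitExp (A C : Finset (Fin n)) : Fin n →₀ ℕ :=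
  expo fun i => (if i ∈ A then 1 else 0) + if i ∈ C then 1 else 0

/-- The translate of `circuitExp (supp a) C` by the degree `a - b`, for `b ⊆ C`. -/
noncomputable def circuitExpShift (a : Fin n → ℕ) (b C : Finset (Fin n)) : Fin n →₀ ℕ :=
  expo fun i => a i + (if i ∈ supp a then 1 else 0) + if i ∈ C \ b then 1 else 0

@[simp] theorem mem_supp {a : Fin n → ℕ} {i : Fin n} : i ∈ supp a ↔ a i ≠ 0 := by simp [supp]

theorem circuitExp_support (A C : Finset (Fin n)) : (circuitExp A C).support = C ∪ A := by
  ext i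
  simp only [circuitExp, Finsupp.mem_support_iff, expo_apply, Finset.mem_union]
  split_ifs <;> simp_all

theorem circuitExpShift_support (a : Fin n → ℕ) (b C : Finset (Fin n)) :
    (circuitExpShift a b C).support = (C \ b) ∪ supp a := by
  ext i
  simp only [circuitExpShift, Finsupp.mem_support_iff, expo_apply, Finset.mem_union]
  by_cases h : i ∈ C \ b <;> by_cases h' : i ∈ supp a <;> simp_all

theorem circuitExpShift_apply (a : Fin n → ℕ) {b C : Finset (Fin n)} (hbC : b ⊆ C) (i : Fin n) :
    (circuitExpShift a b C i : ℤ) = circuitExp (supp a) C i + degreeSub a b i := by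
  have := @hbC i
  simp only [circuitExpShift, circuitExp, degreeSub, expo_apply, Finset.mem_sdiff]
  split_ifs <;> simp_all <;> omega

theorem circuitExp_support_notMem {a : Fin n → ℕ} {b C : Finset (Fin n)} (hb : b.Nonempty)
    (hab : Disjoint (supp a) b) (hC : C ∈ (Δ.link (supp a)).circuitsContaining b) :
    (circuitExp (supp a) C).support ∉ Δ.faces := by
  rw [circuitExp_support]
  exact SimplicialCpx.circuit_link_union_notMem hb hab hC

theorem circuitExpShift_support_mem {a : Fin n → ℕ} {b C : Finset (Fin n)} (hb : b.Nonempty)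
    (hC : C ∈ (Δ.link (supp a)).circuitsContaining b) :
    (circuitExpShift a b C).support ∈ Δ.faces := by
  rw [circuitExpShift_support]
  exact SimplicialCpx.circuit_link_sdiff_mem hb hC

/-- Evaluation of homomorphisms of degree `a - b` at the monomials of the circuits of the link
of `supp a` that contain `b`. -/
noncomputable def evalCircuits (K : Type*) [Field K] (Δ : SimplicialCpx n) {a : Fin n → ℕ}
    {b : Finset (Fin n)} (hb : b.Nonempty) (hab : Disjoint (supp a) b) :
    (Δ.stanleyReisnerIdeal K →ₗ[MvPolynomial (Fin n) K]
      MvPolynomial (Fin n) K ⧸ Δ.stanleyReisnerIdeal K) →ₗ[K]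
      ((Δ.link (supp a)).circuitsContaining b → K) where
  toFun φ C := coeffQ K Δ (circuitExpShift a b C)
    (φ (mon K Δ (circuitExp (supp a) C) (circuitExp_support_notMem hb hab C.2)))
  map_add' φ ψ := by
    ext C
    simp
  map_smul' r φ := by
    ext C
    simp

theorem evalCircuits_apply {a : Fin n → ℕ}
    {b : Finset (Fin n)} (hb : b.Nonempty) (hab : Disjoint (supp a) b)
    (C : (Δ.link (supp a)).circuitsContaining b) :
    evalCircuits K Δ hb hab φ C = coeffQ K Δ (circuitExpShift a b C)
    (φ (mon K Δ (circuitExp (supp a) C) (circuitExp_support_notMem hb hab C.2))) := rfl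

/-- Any nonface monomial with a face target has, after multiplication by x^A, a divisor x^A x^C with
C a circuit of the link. If b ⊆ C its value is one of the vanishing evaluations; otherwise the
divisor goes to a negative degree. No matroid property enters. -/
theorem eq_zero_of_evalCircuits_eq_zero {a : Fin n → ℕ} {b : Finset (Fin n)} (hb : b.Nonempty)
    (hab : Disjoint (supp a) b)
    (hφ : φ ∈ homComponent (Δ.stanleyReisnerIdeal K) (degreeSub a b))
    (h : evalCircuits K Δ hb hab φ = 0) : φ = 0 := by
  refine hom_eq_zero_of_coeffQ hφ fun m hm q hq hface => ?_
  have hab' : ∀ i ∈ b, a i = 0 := fun i hi => by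
    by_contra h'
    exact Finset.disjoint_left.1 hab (mem_supp.2 h') hi
  have hqi : ∀ i, (i ∈ b ∧ a i = 0 ∧ q i + 1 = m i) ∨ (i ∉ b ∧ q i = m i + a i) := fun i => by
    have h1 := hq i
    have h2 := hab' i
    simp only [degreeSub] at h1
    split_ifs at h1 with hi
    · exact Or.inl ⟨hi, h2 hi, by have := h2 hi; omega⟩
    · exact Or.inr ⟨hi, by omega⟩
  -- Multiplying by x^A makes room for the factor x^A of a circuit monomial; the target remains on a
  -- face because its support already contains A.
  let u : Fin n → ℕ := fun i => if i ∈ supp a then 1 else 0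
  have hu : ∀ i, (a i ≠ 0 ∧ u i = 1) ∨ (a i = 0 ∧ u i = 0) := fun i => by
    by_cases hi : a i = 0 <;> simp [u, hi]
  have hmu : (expo fun i => m i + u i).support ∉ Δ.faces := fun h' =>
    hm (Δ.down_closed h' fun i hi => by
      rw [Finsupp.mem_support_iff] at hi ⊢
      rw [expo_apply]
      omega)
  have hqu : (expo fun i => q i + u i).support ∈ Δ.faces := Δ.down_closed hface fun i hi => by
    rw [Finsupp.mem_support_iff, expo_apply] at hi
    rw [Finsupp.mem_support_iff]
    have := hu i
    have := hqi i
    omega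
  rw [← coeffQ_hom_of_le hm hmu (q' := expo fun i => q i + u i) (fun i => by simp)
    (fun i => by simp only [expo_apply]; omega) hqu]
  -- Together with A this set contains the support of m, so it is a nonface of the link.
  have hX : (q.support \ supp a) ∪ b ∉ (Δ.link (supp a)).faces := fun h' =>
    hm (Δ.down_closed h'.2.2 fun i hi => by
      simp only [Finset.mem_union, Finset.mem_sdiff, mem_supp, Finsupp.mem_support_iff] at hi ⊢
      have := hqi i
      by_cases hib : i ∈ b
      · simp [hib]
      · by_cases ha : a i = 0
        · refine Or.inl (Or.inl ⟨?_, by simpa using ha⟩)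
          simp only [hib, not_false_eq_true, false_and, true_and, false_or] at this
          omega
        · exact Or.inr ha)
  obtain ⟨C, hC, hCX⟩ := SimplicialCpx.exists_circuit_subset hX
  have hCi : ∀ i ∈ C, a i = 0 ∧ 1 ≤ m i := fun i hi => by
    have h1 := hCX hi
    simp only [Finset.mem_union, Finset.mem_sdiff, mem_supp, Finsupp.mem_support_iff,
      not_not] at h1
    have h2 := hqi i
    rcases h2 with h2 | h2
    · exact ⟨h2.2.1, by omega⟩
    · have := h1.resolve_right h2.1
      exact ⟨this.2, by omega⟩
  have hle : ∀ i, circuitExp (supp a) C i ≤ (expo fun i => m i + u i) i := fun i => by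
    have h1 := hCi i
    simp only [circuitExp, expo_apply, u]
    split_ifs <;> simp_all
  by_cases hbC : b ⊆ C
  · have h0 := congrFun h ⟨C, hC, hbC⟩
    rw [evalCircuits_apply] at h0
    rw [coeffQ_hom_of_le (circuitExp_support_notMem hb hab ⟨hC, hbC⟩) hmu hle (fun i => ?_) hqu]
    · exact h0
    · have h1 := hq i
      have h2 := circuitExpShift_apply a hbC i
      simp only [expo_apply]
      omega
  · obtain ⟨i, hib, hiC⟩ := Finset.not_subset.1 hbC
    have hCA : C ∪ supp a ∉ Δ.faces := fun h' => hC.1 <| SimplicialCpx.mem_link_of_disjoint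
      (Finset.disjoint_left.2 fun i hi hi' => mem_supp.1 hi' (hCi i hi).1) h'
    rw [← circuitExp_support] at hCA
    rw [hom_mon_eq_zero_of_le hCA hmu hle, map_zero]
    refine hom_apply_mon_eq_zero_of_neg hφ hCA (i := i) ?_
    simp [circuitExp, degreeSub, hiC, hib, hab' i hib]

theorem hom_eq_zero_of_empty {a : Fin n → ℕ}
    (hφ : φ ∈ homComponent (Δ.stanleyReisnerIdeal K) (degreeSub a ∅)) : φ = 0 := by
  refine hom_eq_zero_of_coeffQ hφ fun m hm q hq hface => (hm ?_).elim
  refine Δ.down_closed hface fun i hi => ?_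
  have := hq i
  simp only [degreeSub, Finset.notMem_empty, if_false] at this
  rw [Finsupp.mem_support_iff] at hi ⊢
  omega

theorem hom_eq_zero_of_supp_notMem {a : Fin n → ℕ} {b : Finset (Fin n)}
    (hab : Disjoint (supp a) b) (ha : supp a ∉ Δ.faces)
    (hφ : φ ∈ homComponent (Δ.stanleyReisnerIdeal K) (degreeSub a b)) : φ = 0 := by
  refine hom_eq_zero_of_coeffQ hφ fun m hm q hq hface => (ha ?_).elim
  refine Δ.down_closed hface fun i hi => ?_
  have := hq i
  simp only [degreeSub, Finset.disjoint_left.1 hab hi, if_false] at this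
  rw [mem_supp] at hi
  rw [Finsupp.mem_support_iff]
  omega

/-- Extend the face (C \ b) ∪ A to a face G off b for which G ∪ (b - i) is a nonface. The circuit
monomial divides a monomial with support G ∪ b whose target lives on G. That monomial is also a
multiple of one with support G ∪ (b - i), which maps to degree -1 at i. -/
theorem SimplicialCpx.IsMatroid.evalCircuits_eq_zero (h : Δ.IsMatroid) {a : Fin n → ℕ}
    {b : Finset (Fin n)} (hb : b.Nonempty) (hab : Disjoint (supp a) b)
    (hφ : φ ∈ homComponent (Δ.stanleyReisnerIdeal K) (degreeSub a b))
    (hN : (Δ.nTildeSet b).Nonempty) : evalCircuits K Δ hb hab φ = 0 := by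
  ext ⟨C, hC⟩
  rw [evalCircuits_apply, Pi.zero_apply]
  have hface := SimplicialCpx.circuit_link_sdiff_mem hb hC
  obtain ⟨G, hG, hCG, hGb, i, hib, hi⟩ := h.exists_superset_of_nTildeSet hN hface
    (Finset.disjoint_union_left.2 ⟨Finset.sdiff_disjoint, hab⟩)
  have hCG' : ∀ j, (j ∈ C → j ∉ b → j ∈ G) ∧ (j ∈ supp a → j ∈ G) := fun j =>
    ⟨fun h1 h2 => hCG (by simp [h1, h2]), fun h1 => hCG (Finset.mem_union_right _ h1)⟩
  have hbC := hC.2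
  have hGb' := Finset.disjoint_left.1 hGb
  have hCA := Finset.disjoint_left.1 (SimplicialCpx.disjoint_of_circuit_link hb hab hC)
  let w : Fin n → ℕ := fun j => if j ∈ G ∧ j ∉ C ∧ j ∉ supp a then 1 else 0
  have hsupp : (expo fun j => circuitExp (supp a) C j + w j).support = G ∪ b := by
    ext j
    have h1 := hCG' j
    have h2 := @hbC j
    simp only [Finsupp.mem_support_iff, expo_apply, circuitExp, w, Finset.mem_union]
    by_cases j ∈ b <;> by_cases j ∈ G <;> by_cases j ∈ C <;> by_cases j ∈ supp a <;> simp_all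
  have hm : (expo fun j => circuitExp (supp a) C j + w j).support ∉ Δ.faces := by
    rw [hsupp]
    exact fun h' => hi (Δ.down_closed h'
      (Finset.union_subset_union_right (Finset.erase_subset _ _)))
  have hq : (expo fun j => circuitExpShift a b C j + w j).support ∈ Δ.faces := by
    refine Δ.down_closed hG fun j hj => ?_
    have h1 := hCG' j
    have h2 := (circuitExpShift_support a b C)
    rw [Finset.ext_iff] at h2
    have h3 := h2 j
    simp only [Finsupp.mem_support_iff, expo_apply, w, Finset.mem_union, Finset.mem_sdiff]
      at hj h3
    by_cases hjG : j ∈ G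
    · exact hjG
    · simp only [hjG, false_and, if_false, add_zero] at hj
      rcases h3.1 hj with h4 | h4
      · exact h1.1 h4.1 h4.2
      · exact h1.2 h4
  rw [← coeffQ_hom_of_le (circuitExp_support_notMem hb hab hC) hm (fun j => by simp)
    (fun j => by simp only [expo_apply]; omega) hq]
  have hm' : (expo fun j => if j = i then 0 else circuitExp (supp a) C j + w j).support ∉
      Δ.faces := by
    have : (expo fun j => if j = i then 0 else circuitExp (supp a) C j + w j).support =
        G ∪ b.erase i := by
      ext j
      have h1 := Finset.ext_iff.1 hsupp j
      simp only [Finsupp.mem_support_iff, expo_apply, Finset.mem_union, Finset.mem_erase] at h1 ⊢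
      by_cases hj : j = i
      · subst hj
        simpa using fun h' => hGb' h' hib
      · simpa [hj] using h1
    rwa [this]
  rw [hom_mon_eq_zero_of_le hm' hm (fun j => ?_), map_zero]
  · refine hom_apply_mon_eq_zero_of_neg hφ hm' (i := i) ?_
    have : a i = 0 := by
      by_contra h'
      exact Finset.disjoint_left.1 hab (mem_supp.2 h') hib
    simp [degreeSub, hib, this]
  · simp only [expo_apply]
    split_ifs <;> omega

end Evaluation

/-! ### Surjectivity of evaluation for matroids with Ñ_b empty. -/

section Matroid
variable {K : Type*} [Field K] {n : ℕ} {Δ : SimplicialCpx n}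

/-- This is the case where x^m is killed but x_i x^m is a multiple of x^C: consistency requires the
shift of x_i x^m to vanish in the quotient. If its support were a face, its part F off b would lie
in N_b, and emptiness of Ñ_b would make every F ∪ (b - j) a face. One of these, or an exchange of i
for j in it, would contain the support of m. -/
theorem SimplicialCpx.IsMatroid.support_shift_notMem (h : Δ.IsMatroid) {a : Fin n → ℕ}
    {b C : Finset (Fin n)} (hb : b.Nonempty) (hab : Disjoint (supp a) b)
    (hN : ¬ (Δ.nTildeSet b).Nonempty) (hC : C ∈ (Δ.link (supp a)).circuitsContaining b)
    {m q : Fin n →₀ ℕ} {i : Fin n} (hm : m.support ∉ Δ.faces) (hiC : i ∈ C) (hi : m i = 0)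
    (hCm : ∀ j ∈ C, j ≠ i → m j ≠ 0)
    (hq : ∀ j, j ∉ b → q j = m j + a j + if j = i then 1 else 0) : q.support ∉ Δ.faces := by
  intro hface
  set F := q.support \ b with hF
  have hFΔ : F ∈ Δ.faces := Δ.down_closed hface Finset.sdiff_subset
  have hFmem : ∀ j, j ∉ b → (j ∈ F ↔ (m j ≠ 0 ∨ a j ≠ 0 ∨ j = i)) := fun j hj => by
    simp only [hF, Finset.mem_sdiff, Finsupp.mem_support_iff, hq j hj, hj, not_false_eq_true,
      and_true]
    split_ifs with h' <;> (simp [h']; try omega)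
  have hmF : ∀ j, m j ≠ 0 → j ∉ b → j ∈ F := fun j h1 h2 => (hFmem j h2).2 (Or.inl h1)
  have hFb : F ∈ Δ.nSet b := by
    refine ⟨hFΔ, Finset.sdiff_disjoint, fun h' => hm (Δ.down_closed h' fun j hj => ?_)⟩
    rw [Finsupp.mem_support_iff] at hj
    by_cases hjb : j ∈ b
    · exact Finset.mem_union_right _ hjb
    · exact Finset.mem_union_left _ (hmF j hj hjb)
  have hFj : ∀ j ∈ b, F ∪ b.erase j ∈ Δ.faces := fun j hj => by
    by_contra h'
    exact hN ⟨F, hFb, _, Finset.erase_ssubset hj, h'⟩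
  by_cases hib : i ∈ b
  · refine hm (Δ.down_closed (hFj i hib) fun j hj => ?_)
    rw [Finsupp.mem_support_iff] at hj
    by_cases hjb : j ∈ b
    · refine Finset.mem_union_right _ (Finset.mem_erase.2 ⟨?_, hjb⟩)
      rintro rfl
      exact hj hi
    · exact Finset.mem_union_left _ (hmF j hj hjb)
  · obtain ⟨j, hj⟩ := hb
    have hCA := Finset.disjoint_left.1 (SimplicialCpx.disjoint_of_circuit_link ⟨j, hj⟩ hab hC)
    have hsub : ∀ x, x ≠ i → x ∈ F ∪ b → x ∈ insert j ((F ∪ b.erase j).erase i) := fun x hx => by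
      simp only [Finset.mem_union, Finset.mem_insert, Finset.mem_erase]
      tauto
    -- The exchange is licensed by the circuit C: (C - i) ∪ A is a face, and adding i makes it the
    -- nonface C ∪ A.
    refine hm (Δ.down_closed (h.exchange_mem (P := C.erase i ∪ supp a) (hFj j hj)
      (Finset.mem_union_left _ ((hFmem i hib).2 (by simp))) (j := j) (by simp [hF, hj]) ?_ ?_ ?_) ?_)
    · exact SimplicialCpx.union_mem_of_mem_link (hC.1.2 _ (Finset.erase_ssubset hiC))
    · intro x hx
      simp only [Finset.mem_union, Finset.mem_erase, mem_supp] at hx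
      rcases hx with hx | hx
      · refine hsub x hx.1 ?_
        by_cases hxb : x ∈ b
        · exact Finset.mem_union_right _ hxb
        · exact Finset.mem_union_left _ (hmF x (hCm x hx.2 hx.1) hxb)
      · refine hsub x ?_ (Finset.mem_union_left _ ((hFmem x ?_).2 (Or.inr (Or.inl hx))))
        · rintro rfl
          exact hCA hiC (mem_supp.2 hx)
        · exact Finset.disjoint_left.1 hab (mem_supp.2 hx)
    · rw [← Finset.insert_union, Finset.insert_erase hiC]
      exact SimplicialCpx.circuit_link_union_notMem ⟨j, hj⟩ hab hC
    · intro x hx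
      rw [Finsupp.mem_support_iff] at hx
      refine hsub x (fun e => hx (e ▸ hi)) ?_
      by_cases hxb : x ∈ b
      · exact Finset.mem_union_right _ hxb
      · exact Finset.mem_union_left _ (hmF x hx hxb)

theorem SimplicialCpx.IsMatroid.exists_hom_single (h : Δ.IsMatroid) {a : Fin n → ℕ}
    {b : Finset (Fin n)} (hb : b.Nonempty) (hab : Disjoint (supp a) b)
    (hN : ¬ (Δ.nTildeSet b).Nonempty) (C : (Δ.link (supp a)).circuitsContaining b) :
    ∃ φ ∈ homComponent (Δ.stanleyReisnerIdeal K) (degreeSub a b),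
      ∀ D, evalCircuits K Δ hb hab φ D = if D = C then 1 else 0 := by
  classical
  obtain ⟨C, hC⟩ := C
  -- The truncated subtraction is exact wherever `s` matters, since b ⊆ C ⊆ supp m there.
  let s : (Fin n →₀ ℕ) → Fin n →₀ ℕ := fun m => expo fun i => m i + a i - if i ∈ b then 1 else 0
  let t : (Fin n →₀ ℕ) → MvPolynomial (Fin n) K := fun m =>
    if C ⊆ m.support then monomial (s m) 1 else 0
  obtain ⟨φ, hφ⟩ := exists_hom_of_mon (Δ := Δ) t (fun m i hm => by
    simp only [t]
    by_cases h1 : C ⊆ m.support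
    · have h2 : C ⊆ (m + Finsupp.single i 1).support :=
        h1.trans (Finsupp.support_mono (le_add_of_nonneg_right zero_le))
      rw [if_pos h1, if_pos h2, X, monomial_mul, one_mul]
      have : s (m + Finsupp.single i 1) = Finsupp.single i 1 + s m := by
        ext j
        have := @hC.2 j
        have := @h1 j
        simp only [s, expo_apply, Finsupp.add_apply, Finsupp.mem_support_iff] at this ⊢
        split_ifs <;> simp_all <;> omega
      rw [this, sub_self]
      exact Ideal.zero_mem _
    · rw [if_neg h1, mul_zero, sub_zero]
      split_ifs with h2
      · refine monomial_mem_stanleyReisnerIdeal Δ ?_ 1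
        obtain ⟨k, hkC, hk⟩ := Finset.not_subset.1 h1
        rw [Finsupp.notMem_support_iff] at hk
        have hne : ∀ j ∈ C, j ≠ i → m j ≠ 0 := fun j hj hji => by
          simpa [Finsupp.single_apply, hji.symm] using h2 hj
        obtain rfl : k = i := by
          by_contra hki
          exact hne k hkC hki hk
        refine h.support_shift_notMem hb hab hN hC hm hkC hk hne fun j hj => ?_
        simp only [s, expo_apply, Finsupp.add_apply, hj, if_false, Finsupp.single_apply,
          eq_comm (a := k)]
        omega
      · exact Ideal.zero_mem _)
  refine ⟨φ, mem_homComponent_of_mon fun m hm => ?_, fun D => ?_⟩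
  · rw [hφ]
    refine ⟨t m, ?_, rfl⟩
    simp only [t]
    split_ifs with h1
    · refine (mem_polyComponent_iff (q := s m) fun i => ?_).2 (by simp)
      have := @hC.2 i
      have := @h1 i
      simp only [s, expo_apply, Finsupp.mem_support_iff, degreeSub, Pi.add_apply] at this ⊢
      split_ifs <;> simp_all <;> omega
    · exact Submodule.zero_mem _
  · rw [evalCircuits_apply, hφ, coeffQ_mk (circuitExpShift_support_mem hb D.2)]
    have hCA := Finset.disjoint_left.1 (SimplicialCpx.disjoint_of_circuit_link hb hab hC)
    -- C is disjoint from A, so containment in D ∪ A means containment in D, and distinct circuits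
    -- are incomparable.
    have hiff : C ⊆ (circuitExp (supp a) D.1).support ↔ D = ⟨C, hC⟩ := by
      rw [circuitExp_support]
      constructor
      · intro hs
        refine Subtype.ext (SimplicialCpx.eq_of_circuit_subset hC.1 D.2.1 fun i hi => ?_).symm
        exact (Finset.mem_union.1 (hs hi)).resolve_right (hCA hi)
      · rintro rfl
        exact Finset.subset_union_left
    simp only [t, hiff]
    split_ifs with h1
    · rw [coeff_monomial, if_pos]
      ext i
      have h2 := circuitExpShift_apply a D.2.2 i
      simp only [degreeSub] at h2
      simp only [s, expo_apply]
      split_ifs at h2 ⊢ <;> omega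
    · simp

theorem SimplicialCpx.IsMatroid.exists_hom_evalCircuits_eq (h : Δ.IsMatroid) {a : Fin n → ℕ}
    {b : Finset (Fin n)} (hb : b.Nonempty) (hab : Disjoint (supp a) b)
    (hN : ¬ (Δ.nTildeSet b).Nonempty) (g : (Δ.link (supp a)).circuitsContaining b → K) :
    ∃ φ ∈ homComponent (Δ.stanleyReisnerIdeal K) (degreeSub a b),
      evalCircuits K Δ hb hab φ = g := by
  classical
  have := Fintype.ofFinite ((Δ.link (supp a)).circuitsContaining b)
  choose φ hφ hφe using h.exists_hom_single (K := K) hb hab hN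
  refine ⟨∑ C, g C • φ C, Submodule.sum_mem _ fun C _ => Submodule.smul_mem _ _ (hφ C), ?_⟩
  ext D
  simp [hφe]

end Matroid

/-! ### Evaluations of the homomorphisms induced by derivations. -/

section Derivations
variable {K : Type*} [Field K] {n : ℕ} {Δ : SimplicialCpx n}

theorem derivation_monomial (D : Derivation K (MvPolynomial (Fin n) K) (MvPolynomial (Fin n) K))
    (m : Fin n →₀ ℕ) :
    D (monomial m 1) = ∑ i, monomial (m - Finsupp.single i 1) (m i : K) * D (X i) := by
  have : D = mkDerivation K fun i => D (X i) := derivation_ext fun i => by simp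
  rw [this, mkDerivation_monomial, one_smul, Finsupp.sum_fintype _ _ (by simp)]
  simp

theorem derToHom_mon (D : Derivation K (MvPolynomial (Fin n) K) (MvPolynomial (Fin n) K))
    (m : Fin n →₀ ℕ) (hm : m.support ∉ Δ.faces) :
    derToHom (Δ.stanleyReisnerIdeal K) D (mon K Δ m hm) =
      Ideal.Quotient.mk _ (∑ i, monomial (m - Finsupp.single i 1) (m i : K) * D (X i)) := by
  rw [← derivation_monomial]
  rfl

variable {a : Fin n → ℕ} {b : Finset (Fin n)}

theorem circuitExp_apply_of_mem {C : Finset (Fin n)} (hab : Disjoint (supp a) b)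
    (hbC : b ⊆ C) {i : Fin n} (hi : i ∈ b) :
    circuitExp (supp a) C i = 1 ∧ circuitExpShift a b C i = 0 := by
  have h1 : a i = 0 := by
    by_contra h'
    exact Finset.disjoint_left.1 hab (mem_supp.2 h') hi
  simp [circuitExp, circuitExpShift, h1, hi, hbC hi]

/-- Differentiating by x_i leaves the factor x_l in place, whereas the target monomial does not
involve x_l. -/
theorem coeff_circuitExpShift_eq_zero {C : Finset (Fin n)} (hab : Disjoint (supp a) b)
    (hbC : b ⊆ C) {i l : Fin n} (hl : l ∈ b) (hli : l ≠ i) (r : K) (f : MvPolynomial (Fin n) K) :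
    coeff (circuitExpShift a b C)
      (monomial (circuitExp (supp a) C - Finsupp.single i 1) r * f) = 0 := by
  rw [coeff_monomial_mul', if_neg]
  intro hle
  have h1 := hle l
  have h2 := circuitExp_apply_of_mem hab hbC hl
  simp [hli.symm, h2.1, h2.2] at h1

theorem evalCircuits_derToHom_eq_zero (hb : b.Nonempty) (hab : Disjoint (supp a) b)
    (hb2 : b.card ≠ 1)
    (D : Derivation K (MvPolynomial (Fin n) K) (MvPolynomial (Fin n) K)) :
    evalCircuits K Δ hb hab (derToHom _ D) = 0 := by
  ext C
  rw [evalCircuits_apply, derToHom_mon, coeffQ_mk (circuitExpShift_support_mem hb C.2),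
    coeff_sum, Pi.zero_apply]
  refine Finset.sum_eq_zero fun i _ => ?_
  obtain ⟨l, hl, hli⟩ := Finset.exists_mem_ne
    (by have := Finset.card_pos.2 hb; omega : 1 < b.card) i
  exact coeff_circuitExpShift_eq_zero hab C.2.2 hl hli _ _

/-- The variable x_j occurs to the first power in every circuit monomial, so its derivative has
coefficient 1 in any characteristic and the value does not depend on the circuit. -/
theorem evalCircuits_derToHom_singleton {j : Fin n} (hb : ({j} : Finset (Fin n)).Nonempty)
    (hab : Disjoint (supp a) {j})
    (D : Derivation K (MvPolynomial (Fin n) K) (MvPolynomial (Fin n) K)) :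
    evalCircuits K Δ hb hab (derToHom _ D) = fun _ => coeff (expo a) (D (X j)) := by
  ext C
  rw [evalCircuits_apply, derToHom_mon, coeffQ_mk (circuitExpShift_support_mem hb C.2),
    coeff_sum, Finset.sum_eq_single j]
  · have h1 := circuitExp_apply_of_mem hab C.2.2 (Finset.mem_singleton_self j)
    have h2 : circuitExpShift a {j} C.1 =
        (circuitExp (supp a) C.1 - Finsupp.single j 1) + expo a := by
      ext i
      have h3 := circuitExpShift_apply a C.2.2 i
      simp only [degreeSub, Finset.mem_singleton] at h3
      simp only [Finsupp.add_apply, Finsupp.tsub_apply, Finsupp.single_apply, expo_apply,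
        eq_comm (a := j)]
      split_ifs at h3 ⊢ with hij
      · subst hij
        omega
      · omega
    rw [h2, coeff_monomial_mul, h1.1]
    simp
  · intro i _ hij
    exact coeff_circuitExpShift_eq_zero hab C.2.2 (Finset.mem_singleton_self j) hij.symm _ _
  · simp

theorem derToHom_monomial_mem_homComponent (a : Fin n → ℕ) (j : Fin n) :
    derToHom (Δ.stanleyReisnerIdeal K)
        (mkDerivation K fun i => if i = j then monomial (expo a) 1 else 0) ∈
      homComponent (Δ.stanleyReisnerIdeal K) (degreeSub a {j}) := by
  refine mem_homComponent_of_mon fun m hm => ?_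
  rw [derToHom_mon]
  refine ⟨_, ?_, rfl⟩
  simp only [mkDerivation_X, mul_ite, mul_zero, Finset.sum_ite_eq', Finset.mem_univ, if_true,
    monomial_mul, mul_one]
  by_cases hmj : m j = 0
  · simp only [hmj, Nat.cast_zero, monomial_zero]
    exact Submodule.zero_mem _
  · refine (mem_polyComponent_iff (q := m - Finsupp.single j 1 + expo a) fun i => ?_).2 (by simp)
    simp only [degreeSub, Finset.mem_singleton, Finsupp.add_apply, Finsupp.tsub_apply,
      Finsupp.single_apply, expo_apply, eq_comm (a := j), Pi.add_apply]
    split_ifs with hij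
    · subst hij
      omega
    · omega

end Derivations

/-! ### Dimension counts for restricted linear maps. -/

section LinearAlgebra
variable {K V U : Type*} [Field K] [AddCommGroup V] [Module K V] [AddCommGroup U] [Module K U]

theorem rank_map_eq_finrank (W : Submodule K V) (f : V →ₗ[K] U) [Module.Finite K W] :
    Module.rank K (W.map f) = Module.finrank K (W.map f) :=
  (Module.finrank_eq_rank _ _).symm

theorem finrank_map_add_finrank_ker (W : Submodule K V) (f : V →ₗ[K] U) [Module.Finite K W] :
    Module.finrank K (W.map f) + Module.finrank K (LinearMap.ker (f.domRestrict W)) =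
      Module.finrank K W := by
  rw [← LinearMap.finrank_range_add_finrank_ker (f.domRestrict W), LinearMap.range_domRestrict]

theorem exists_mem_of_injective_domRestrict {W : Submodule K V} {f : V →ₗ[K] U}
    [Module.Finite K W] [Module.Finite K U] (hf : Function.Injective (f.domRestrict W))
    (h : Module.finrank K W = Module.finrank K U) (u : U) : ∃ w ∈ W, f w = u := by
  obtain ⟨w, hw⟩ := (LinearMap.injective_iff_surjective_of_finrank_eq_finrank h).1 hf u
  exact ⟨w, w.2, hw⟩

theorem finrank_ker_domRestrict_eq_one {W : Submodule K V} {f : V →ₗ[K] U} {v : V} (hvW : v ∈ W)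
    (hfv : f v = 0) (hv : v ≠ 0) (h : ∀ w ∈ W, f w = 0 → ∃ c : K, c • v = w) :
    Module.finrank K (LinearMap.ker (f.domRestrict W)) = 1 := by
  refine finrank_eq_one_iff'.2 ⟨⟨⟨v, hvW⟩, hfv⟩, fun h0 => ?_, fun ψ => ?_⟩
  · exact hv (congrArg (fun x => (x.1 : V)) h0)
  · obtain ⟨c, hc⟩ := h ψ.1 ψ.1.2 ψ.2
    exact ⟨c, Subtype.ext (Subtype.ext hc)⟩

end LinearAlgebra

/-! ### The dimension of T¹ in a given degree. -/

section Rank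
variable {K : Type*} [Field K] {n : ℕ} {Δ : SimplicialCpx n} {a : Fin n → ℕ}
  {b : Finset (Fin n)}

theorem evalCircuits_injective (hb : b.Nonempty) (hab : Disjoint (supp a) b) :
    Function.Injective ((evalCircuits K Δ hb hab).domRestrict
      (homComponent (Δ.stanleyReisnerIdeal K) (degreeSub a b))) := by
  refine (injective_iff_map_eq_zero _).2 fun φ hφ => ?_
  exact Subtype.ext (eq_zero_of_evalCircuits_eq_zero hb hab φ.2 hφ)

theorem finite_homComponent (hb : b.Nonempty) (hab : Disjoint (supp a) b) :
    Module.Finite K (homComponent (Δ.stanleyReisnerIdeal K) (degreeSub a b)) :=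
  Module.Finite.of_injective _ (evalCircuits_injective hb hab)

theorem rank_T1Component_eq_zero {I : Ideal (MvPolynomial (Fin n) K)} {c : Fin n → ℤ}
    (h : ∀ φ ∈ homComponent I c, φ = 0) : Module.rank K (T1Component I c) = 0 := by
  have h1 : homComponent I c = ⊥ := (Submodule.eq_bot_iff _).2 h
  rw [T1Component, h1, Submodule.map_bot, rank_bot]

theorem rank_T1Component_eq_finrank (hb : b.Nonempty) (hab : Disjoint (supp a) b) :
    Module.rank K (T1Component (Δ.stanleyReisnerIdeal K) (degreeSub a b)) =
      Module.finrank K (T1Component (Δ.stanleyReisnerIdeal K) (degreeSub a b)) := by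
  have := finite_homComponent (K := K) (Δ := Δ) hb hab
  exact rank_map_eq_finrank _ _

/-- The projection from `Hom_c` to `T¹`. -/
noncomputable def homToT1 (I : Ideal (MvPolynomial (Fin n) K)) (c : Fin n → ℤ) :
    homComponent I c →ₗ[K] T1 I :=
  ((LinearMap.range (derToHom I)).mkQ.restrictScalars K).domRestrict (homComponent I c)

theorem homToT1_eq_zero_iff {I : Ideal (MvPolynomial (Fin n) K)} {c : Fin n → ℤ}
    (φ : homComponent I c) : homToT1 I c φ = 0 ↔ ∃ D, derToHom I D = φ := by
  change Submodule.Quotient.mk _ = _ ↔ _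
  rw [Submodule.Quotient.mk_eq_zero, LinearMap.mem_range]
  rfl

theorem finrank_T1Component_add (hb : b.Nonempty) (hab : Disjoint (supp a) b) :
    Module.finrank K (T1Component (Δ.stanleyReisnerIdeal K) (degreeSub a b)) +
      Module.finrank K (LinearMap.ker (homToT1 (Δ.stanleyReisnerIdeal K) (degreeSub a b))) =
      Module.finrank K (homComponent (Δ.stanleyReisnerIdeal K) (degreeSub a b)) := by
  have := finite_homComponent (K := K) (Δ := Δ) hb hab
  exact finrank_map_add_finrank_ker _ _

theorem finrank_ker_homToT1_of_card_ne_one (hb : b.Nonempty) (hab : Disjoint (supp a) b)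
    (hb2 : b.card ≠ 1) :
    Module.finrank K (LinearMap.ker (homToT1 (Δ.stanleyReisnerIdeal K) (degreeSub a b))) = 0 := by
  have : LinearMap.ker (homToT1 (Δ.stanleyReisnerIdeal K) (degreeSub a b)) = ⊥ := by
    rw [LinearMap.ker_eq_bot']
    intro φ hφ
    obtain ⟨D, hD⟩ := (homToT1_eq_zero_iff φ).1 hφ
    refine Subtype.ext (eq_zero_of_evalCircuits_eq_zero hb hab φ.2 ?_)
    rw [← hD, evalCircuits_derToHom_eq_zero hb hab hb2]
  rw [this, finrank_bot]

/-- The kernel is the line spanned by x^a ∂_j. A circuit is needed for this homomorphism to be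
nonzero. -/
theorem finrank_ker_homToT1_singleton {j : Fin n} (hab : Disjoint (supp a) {j})
    (hC : ((Δ.link (supp a)).circuitsContaining {j}).Nonempty) :
    Module.finrank K (LinearMap.ker (homToT1 (Δ.stanleyReisnerIdeal K) (degreeSub a {j}))) = 1 := by
  have hb : ({j} : Finset (Fin n)).Nonempty := Finset.singleton_nonempty j
  let D₀ : Derivation K (MvPolynomial (Fin n) K) (MvPolynomial (Fin n) K) :=
    mkDerivation K fun i => if i = j then monomial (expo a) 1 else 0
  have hD₀ : evalCircuits K Δ hb hab (derToHom _ D₀) = fun _ => 1 := by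
    rw [evalCircuits_derToHom_singleton]
    simp [D₀]
  refine finrank_ker_domRestrict_eq_one (derToHom_monomial_mem_homComponent a j)
    ((homToT1_eq_zero_iff ⟨_, derToHom_monomial_mem_homComponent a j⟩).2 ⟨D₀, rfl⟩)
    (fun h0 => ?_) fun ψ hψ hψ0 => ?_
  · obtain ⟨C, hC⟩ := hC
    have h1 := congrFun hD₀ ⟨C, hC⟩
    rw [show derToHom (Δ.stanleyReisnerIdeal K) D₀ = 0 from h0, map_zero] at h1
    exact zero_ne_one h1
  · obtain ⟨D, hD⟩ := (homToT1_eq_zero_iff ⟨ψ, hψ⟩).1 hψ0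
    -- D need not be homogeneous: evaluation sees only the x^a-coefficient of D(x_j), and evaluation
    -- is injective on this degree.
    refine ⟨coeff (expo a) (D (X j)), sub_eq_zero.1 (eq_zero_of_evalCircuits_eq_zero hb hab
      (Submodule.sub_mem _ (Submodule.smul_mem _ _ (derToHom_monomial_mem_homComponent a j)) hψ)
      ?_)⟩
    rw [map_sub, map_smul, sub_eq_zero]
    change _ • evalCircuits K Δ hb hab (derToHom _ D₀) = _
    rw [hD₀, show ψ = _ from hD.symm, evalCircuits_derToHom_singleton]
    ext
    simp

theorem finrank_circuits (Γ : SimplicialCpx n) (b : Finset (Fin n)) :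
    Module.finrank K (Γ.circuitsContaining b → K) = (Γ.circuitsContaining b).ncard := by
  have := Fintype.ofFinite (Γ.circuitsContaining b)
  rw [Module.finrank_fintype_fun_eq_card, Set.ncard_eq_toFinset_card', Set.toFinset_card]

theorem SimplicialCpx.IsMatroid.finrank_homComponent (h : Δ.IsMatroid) (hb : b.Nonempty)
    (hab : Disjoint (supp a) b) (hN : ¬ (Δ.nTildeSet b).Nonempty) :
    Module.finrank K (homComponent (Δ.stanleyReisnerIdeal K) (degreeSub a b)) =
      ((Δ.link (supp a)).circuitsContaining b).ncard := by
  rw [← finrank_circuits (K := K)]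
  refine (LinearEquiv.ofBijective _ ⟨evalCircuits_injective hb hab, fun g => ?_⟩).finrank_eq
  obtain ⟨φ, hφ, hφg⟩ := h.exists_hom_evalCircuits_eq hb hab hN g
  exact ⟨⟨φ, hφ⟩, hφg⟩

theorem SimplicialCpx.IsMatroid.rank_T1Component (h : Δ.IsMatroid)
    (hab : Disjoint (supp a) b) :
    Module.rank K (T1Component (Δ.stanleyReisnerIdeal K) (degreeSub a b)) =
      (Δ.circuitFormula (supp a) b : Cardinal) := by
  rw [SimplicialCpx.circuitFormula]
  by_cases hA : supp a ∉ Δ.faces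
  · rw [if_pos (Or.inl hA), Nat.cast_zero]
    exact rank_T1Component_eq_zero fun φ hφ => hom_eq_zero_of_supp_notMem hab hA hφ
  rcases b.eq_empty_or_nonempty with rfl | hb
  · rw [if_pos (Or.inr (Or.inl rfl)), Nat.cast_zero]
    exact rank_T1Component_eq_zero fun φ hφ => hom_eq_zero_of_empty hφ
  by_cases hN : (Δ.nTildeSet b).Nonempty
  · rw [if_pos (Or.inr (Or.inr hN)), Nat.cast_zero]
    exact rank_T1Component_eq_zero fun φ hφ => eq_zero_of_evalCircuits_eq_zero hb hab hφ
      (h.evalCircuits_eq_zero hb hab hφ hN)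
  rw [if_neg (by simp only [not_or]; exact ⟨hA, hb.ne_empty, hN⟩),
    rank_T1Component_eq_finrank hb hab, Nat.cast_inj]
  have hadd := finrank_T1Component_add (K := K) (Δ := Δ) hb hab
  rw [h.finrank_homComponent hb hab hN] at hadd
  split_ifs with hcard
  · obtain ⟨j, rfl⟩ := Finset.card_eq_one.1 hcard
    -- Without circuits Hom is already zero, in agreement with the truncated 0 - 1.
    rcases ((Δ.link (supp a)).circuitsContaining {j}).eq_empty_or_nonempty with h0 | hC
    · rw [h0, Set.ncard_empty] at hadd ⊢
      omega
    · rw [finrank_ker_homToT1_singleton hab hC] at hadd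
      omega
  · rw [finrank_ker_homToT1_of_card_ne_one hb hab hcard] at hadd
    omega

end Rank

/-! ### From the dimension formula back to circuit elimination. -/

section Converse
variable {K : Type*} [Field K] {n : ℕ} {Δ : SimplicialCpx n}

/-- If the union of two circuits through `v`, minus `v`, is a face, then homomorphisms of degree
`-v` take the same value at both circuits. -/
theorem evalCircuits_eq_of_union_mem {v : Fin n} (hv : ({v} : Finset (Fin n)).Nonempty)
    (h0 : Disjoint (supp (0 : Fin n → ℕ)) {v})
    (C D : (Δ.link (supp (0 : Fin n → ℕ))).circuitsContaining {v})
    (hCD : (C.1 ∪ D.1).erase v ∈ Δ.faces)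
    (φ : Δ.stanleyReisnerIdeal K →ₗ[MvPolynomial (Fin n) K]
      MvPolynomial (Fin n) K ⧸ Δ.stanleyReisnerIdeal K) :
    evalCircuits K Δ hv h0 φ C = evalCircuits K Δ hv h0 φ D := by
  have hs : supp (0 : Fin n → ℕ) = ∅ := by simp [supp]
  have hm : (expo fun i => if i ∈ C.1 ∪ D.1 then 1 else 0).support ∉ Δ.faces := fun h' => by
    refine circuitExp_support_notMem hv h0 C.2 (Δ.down_closed h' fun i hi => ?_)
    rw [circuitExp_support, Finset.mem_union] at hi
    simp [hi.resolve_right (by simp)]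
  have hq : (expo fun i => if i ∈ (C.1 ∪ D.1).erase v then 1 else 0).support ∈ Δ.faces := by
    refine Δ.down_closed hCD fun i hi => ?_
    rw [Finsupp.mem_support_iff, expo_apply] at hi
    exact (ite_ne_right_iff.1 hi).1
  have hvC : v ∈ C.1 := C.2.2 (Finset.mem_singleton_self v)
  have hvD : v ∈ D.1 := D.2.2 (Finset.mem_singleton_self v)
  -- Both circuit monomials divide the squarefree monomial of C ∪ D, whose target is the face
  -- monomial of (C ∪ D) - v; each value equals the value there.
  have key : ∀ E : (Δ.link (supp (0 : Fin n → ℕ))).circuitsContaining {v}, E.1 ⊆ C.1 ∪ D.1 →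
      evalCircuits K Δ hv h0 φ E = coeffQ K Δ
        (expo fun i => if i ∈ (C.1 ∪ D.1).erase v then 1 else 0) (φ (mon K Δ _ hm)) := by
    intro E hE
    rw [evalCircuits_apply]
    refine (coeffQ_hom_of_le (circuitExp_support_notMem hv h0 E.2) hm (fun i => ?_)
      (fun i => ?_) hq).symm
    · have := @hE i
      simp only [circuitExp, hs, expo_apply]
      split_ifs <;> simp_all
    · have h1 := @hE i
      have h2 := circuitExpShift_apply (0 : Fin n → ℕ) E.2.2 i
      have h3 : v ∈ E.1 := E.2.2 (Finset.mem_singleton_self v)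
      simp only [degreeSub, Finset.mem_singleton, Pi.zero_apply] at h2
      simp only [expo_apply, Finset.mem_erase]
      by_cases hiv : i = v
      · subst hiv
        simp only [if_true] at h2
        simp [hvC]
        omega
      · simp only [hiv, if_false] at h2
        simp only [ne_eq, hiv, not_false_eq_true, true_and]
        omega
  rw [key C Finset.subset_union_left, key D Finset.subset_union_right]

theorem isMatroid_of_rank_T1Component (hΔ : Δ.faces.Nonempty)
    (h : ∀ v : Fin n, Module.rank K (T1Component (Δ.stanleyReisnerIdeal K) (degreeSub 0 {v})) =
      (Δ.circuitFormula (supp 0) {v} : Cardinal)) : Δ.IsMatroid := by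
  classical
  refine SimplicialCpx.isMatroid_of_elimination hΔ fun C hC D hD hne v hvC hvD hface => ?_
  have hs : supp (0 : Fin n → ℕ) = ∅ := by simp [supp]
  have hv : ({v} : Finset (Fin n)).Nonempty := Finset.singleton_nonempty v
  have h0 : Disjoint (supp (0 : Fin n → ℕ)) {v} := by simp [hs]
  have hlink : Δ.link (supp (0 : Fin n → ℕ)) = Δ := by rw [hs, SimplicialCpx.link_empty]
  have hC' : C ∈ (Δ.link (supp (0 : Fin n → ℕ))).circuitsContaining {v} := by
    rw [hlink]
    exact ⟨hC, by simpa using hvC⟩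
  have hD' : D ∈ (Δ.link (supp (0 : Fin n → ℕ))).circuitsContaining {v} := by
    rw [hlink]
    exact ⟨hD, by simpa using hvD⟩
  -- The only proper subset of {v} is empty, and F itself is a face.
  have hN : ¬ (Δ.nTildeSet {v}).Nonempty := by
    rintro ⟨F, hF, b', hb', hFb'⟩
    rw [Finset.ssubset_singleton_iff] at hb'
    rw [hb', Finset.union_empty] at hFb'
    exact hFb' hF.1
  have hE : supp (0 : Fin n → ℕ) ∈ Δ.faces := by
    obtain ⟨F, hF⟩ := hΔ
    rw [hs]
    exact Δ.down_closed hF (Finset.empty_subset _)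
  have hr := h v
  rw [rank_T1Component_eq_finrank hv h0, Nat.cast_inj, SimplicialCpx.circuitFormula,
    if_neg (by simp only [not_or, not_not]; exact ⟨hE, hv.ne_empty, hN⟩),
    if_pos (Finset.card_singleton v)] at hr
  have hadd := finrank_T1Component_add (K := K) (Δ := Δ) hv h0
  rw [finrank_ker_homToT1_singleton h0 ⟨C, hC'⟩, hr] at hadd
  -- Positivity makes (N - 1) + 1 = N in ℕ, with N the number of circuits through v. So Hom has full
  -- dimension N and contains a φ separating C from D.
  have hpos : 0 < ((Δ.link (supp (0 : Fin n → ℕ))).circuitsContaining {v}).ncard :=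
    (Set.ncard_pos (Set.toFinite _)).2 ⟨C, hC'⟩
  have := finite_homComponent (K := K) (Δ := Δ) hv h0
  obtain ⟨φ, -, hφ⟩ := exists_mem_of_injective_domRestrict
    (evalCircuits_injective (K := K) (Δ := Δ) hv h0)
    (by rw [finrank_circuits]; omega) (Pi.single ⟨C, hC'⟩ 1)
  have h1 := evalCircuits_eq_of_union_mem hv h0 ⟨C, hC'⟩ ⟨D, hD'⟩ hface φ
  rw [hφ, Pi.single_eq_same, Pi.single_eq_of_ne (by simpa using hne.symm)] at h1
  exact one_ne_zero h1

end Converse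
end MatroidT1

theorem mainTheorem1 {K : Type*} [Field K] {n : ℕ} (Δ : MatroidT1.SimplicialCpx n)
    (hΔ : Δ.faces.Nonempty) :
    Δ.IsMatroid ↔
      ∀ (a : Fin n → ℕ) (b : Finset (Fin n)), Disjoint (MatroidT1.supp a) b →
        Module.rank K
            (MatroidT1.T1Component (Δ.stanleyReisnerIdeal K) (MatroidT1.degreeSub a b)) =
          (Δ.circuitFormula (MatroidT1.supp a) b : Cardinal) :=
  ⟨fun h _ _ hab => h.rank_T1Component hab, fun h =>
    MatroidT1.isMatroid_of_rank_T1Component (K := K) hΔ fun v => h 0 {v}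
      (by simp [MatroidT1.supp])⟩
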